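/- Let $p$ be a prime, let $q$ be a positive power of $p$, and let $\mathbb{F}_{q^2}$ be a finite field of order $q^2$. Let $\gamma\ge 0$ be the integer with $2^\gamma \,\|\, (q+1)$, that is, $2^\gamma\mid q+1$ and $2^{\gamma+1}\nmid q+1$. Let $n=\overline{n}\,p^\nu$ be a positive integer, where $p\nmid\overline{n}$ and $\nu\ge 0$. Let $\lambda\in\mathbb{F}_{q^2}\setminus\{0\}$ have multiplicative order $r$, and suppose that $r\mid (q+1)$. A $\lambda$-constacyclic code of length $n$ is a linear subspace $C\subseteq\mathbb{F}_{q^2}^n$ such that $(\lambda c_{n-1},c_0,\dots,c_{n-2})\in C$ whenever $(c_0,c_1,\dots,c_{n-1})\in C$; let $\mathcal{C}(n,\lambda,q^2)$ be the set of all of them. Put $C^{\perp_H}=\{u\in\mathbb{F}_{q^2}^n : \sum_{i=0}^{n-1} u_iv_i^q=0 \text{ for all } v\in C\}$ and $\mathrm{Hull}_H(C)=C\cap C^{\perp_H}$, and let $$E_H(n,\lambda,q^2)=\sum_{C\in\mathcal{C}(n,\lambda,q^2)}\frac{\dim \mathrm{Hull}_H(C)}{|\mathcal{C}(n,\lambda,q^2)|}$$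 be the average dimension of the Hermitian hull. Let $M_q$ be the set of integers $\ell\ge 1$ that divide $q^i+1$ for some odd positive integer $i$, and for a positive integer $\ell$ let $\beta(\ell)$ be the exponent of $2$ in the prime factorization of $\ell$. Then all of the following hold. 1. $E_H(n,\lambda,q^2)=0$ if and only if $\beta(\overline{n})+\beta(r)\le\gamma$ and $r,n\in M_q$. 2. If $r$ is even, then (a) $\frac n6\le E_H(n,\lambda,q^2)<\frac n3$ if $\beta(\overline{n})+\beta(r)\le\gamma$, $r\in M_q$ and $n\notin M_q$; (b) $\frac n4\le E_H(n,\lambda,q^2)<\frac n3$ if $\beta(\overline{n})+\beta(r)>\gamma$ or $r\notin M_q$. 3. If $r$ is odd, then (a) $\frac n8\le E_H(n,\lambda,q^2)<\frac n3$ if $r\in M_q$ and $n\notin M_q$; (b) $\frac n4\le E_H(n,\lambda,q^2)<\frac n3$ if $r\notin M_q$. Consequently, either $E_H(n,\lambda,q^2)=0$ or $\frac n8\le E_H(n,\lambda,q^2)<\frac n3$. -/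

import Mathlib

/-- The Hermitian dual of a linear code `C` of length `n` over `F` (of order `q ^ 2`): all `u` with
`∑ i, u i * (v i) ^ q = 0` for every `v ∈ C`. -/
def hermitianDual {F : Type*} [Field F] {n : ℕ} (q : ℕ) (C : Submodule F (Fin n → F)) :
    Submodule F (Fin n → F) where
  carrier := {u | ∀ v ∈ C, ∑ i, u i * v i ^ q = 0}
  zero_mem' := by
    intro v _
    simp
  add_mem' := by
    intro a b ha hb v hv
    simp only [Pi.add_apply, add_mul, Finset.sum_add_distrib, ha v hv, hb v hv, add_zero]
  smul_mem' := by
    intro c a ha v hv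
    simp only [Pi.smul_apply, smul_eq_mul, mul_assoc, ← Finset.mul_sum, ha v hv, mul_zero]

/-- The Hermitian hull `C ∩ C^{⊥_H}`. -/
def hermitianHull {F : Type*} [Field F] {n : ℕ} (q : ℕ) (C : Submodule F (Fin n → F)) :
    Submodule F (Fin n → F) :=
  C ⊓ hermitianDual q C

/-- The `lam`-constacyclic shift
`(c₀, c₁, …, c_{n-1}) ↦ (lam * c_{n-1}, c₀, …, c_{n-2})`. -/
def constacyclicShift {F : Type*} [Field F] {n : ℕ} (lam : F) (c : Fin n → F) : Fin n → F :=
  fun i =>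
    if i.val = 0 then lam * c ⟨n - 1, Nat.sub_one_lt_of_lt i.isLt⟩
    else c ⟨i.val - 1, (Nat.sub_le i.val 1).trans_lt i.isLt⟩

/-- The set of all `lam`-constacyclic codes of length `n` over `F`. -/
def constacyclicCodes {F : Type*} [Field F] (n : ℕ) (lam : F) :
    Set (Submodule F (Fin n → F)) :=
  {C | ∀ c ∈ C, constacyclicShift lam c ∈ C}

/-- The average dimension of the Hermitian hull of the `lam`-constacyclic codes of length `n`
over the finite field `F` (of order `q ^ 2`). -/
noncomputable def avgHermitianHullDim {F : Type*} [Field F] [Finite F] (n : ℕ) (lam : F)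
    (q : ℕ) : ℝ :=
  ∑ C ∈ (Set.toFinite (constacyclicCodes n lam)).toFinset,
    (Module.finrank F (hermitianHull q C) : ℝ) / ((constacyclicCodes n lam).ncard : ℝ)

/-- `M_q`: the positive integers dividing `q ^ i + 1` for some odd positive integer `i`. -/
def oddGoodIntegers (q : ℕ) : Set ℕ :=
  {l | 1 ≤ l ∧ ∃ i : ℕ, Odd i ∧ l ∣ q ^ i + 1}

open Polynomial

/-! Write `N = p ^ ν` and let `μ` be the `N`-th root of `lam`, so that `X ^ n - lam = (X ^ nbar - μ)
^ N = ∏ f i ^ N` with distinct monic irreducible `f i`. Constacyclic codes correspond to exponent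
vectors `e` with `0 ≤ e i ≤ N`. Conjugate reciprocation permutes the `f i` by an involution `τ`, and
the hull has exponents `max (e i) (N - e (τ i))`, hence dimension `∑ deg (f i) * min (N - e i) (e (τ
i))`.

For a uniformly random code the exponents are independent, so `f i` contributes per degree `selfMean
N` if `τ i = i` and `pairMean N` otherwise. A root `x` of `f i` has `x⁻¹ ^ q` as a root of `f (τ
i)`, and these are conjugate over `F` exactly when `orderOf x ∈ M_q`. With `s` the number of roots
of `X ^ nbar - μ` of such good order, the average is `s * selfMean N + (nbar - s) * pairMean N`.

Both means are below `N / 3`; `pairMean N ≥ N / 4`, while `selfMean` vanishes at `1` and is at least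
`N / 6` from `2` on. It remains to control `s`. Good roots lie in one coset of a group whose order
`h` divides `nbar` and is in `M_q`; if `nbar ∉ M_q` then `h ≤ nbar / 2`, improved to `nbar / 3` when
the 2-part of `nbar` divides `q + 1`. If `r` is even and the 2-adic condition fails, `s = 0`; if `r
* nbar ∈ M_q`, `s = nbar`. -/

/-! ### Means of minima of uniform exponents -/

theorem sum_min_reflect (N : ℕ) :
    ∑ j ∈ Finset.range (N + 1), min j (N - j) = N ^ 2 / 4 := by
  induction N using Nat.twoStepInduction with
  | zero => simp
  | one => simp [Finset.sum_range_succ]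
  | more N ih _ =>
    rw [Finset.sum_range_succ, Finset.sum_range_succ']
    -- The two end terms are zero and each of the `N + 1` interior terms exceeds its predecessor by
    -- one.
    have h : ∑ k ∈ Finset.range (N + 1), min (k + 1) (N + 2 - (k + 1)) =
        ∑ k ∈ Finset.range (N + 1), (min k (N - k) + 1) := by
      refine Finset.sum_congr rfl fun k hk => ?_
      have := Finset.mem_range.mp hk
      omega
    rw [h, Finset.sum_add_distrib, ih]
    have : (N + 2) ^ 2 = N ^ 2 + (N + 1) * 4 := by ring
    rw [this, Nat.add_mul_div_right _ _ (by norm_num)]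
    simp

theorem six_mul_sum_sum_min (N : ℕ) :
    6 * ∑ j ∈ Finset.range (N + 1), ∑ k ∈ Finset.range (N + 1), min j k =
      N * (N + 1) * (2 * N + 1) := by
  induction N with
  | zero => simp
  | succ N ih =>
    have h1 : ∀ j ∈ Finset.range (N + 1), ∑ k ∈ Finset.range (N + 1 + 1), min j k =
        ∑ k ∈ Finset.range (N + 1), min j k + j := by
      intro j hj
      rw [Finset.sum_range_succ, min_eq_left (Finset.mem_range.mp hj).le]
    have h2 : ∑ k ∈ Finset.range (N + 1), min (N + 1) k = ∑ k ∈ Finset.range (N + 1), k :=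
      Finset.sum_congr rfl fun k hk => min_eq_right (Finset.mem_range.mp hk).le
    have h3 := Finset.sum_range_id_mul_two (N + 1)
    simp only [add_tsub_cancel_right] at h3
    rw [Finset.sum_range_succ, Finset.sum_congr rfl h1, Finset.sum_add_distrib,
      Finset.sum_range_succ (fun k => min (N + 1) k), h2, min_self]
    nlinarith

theorem six_mul_sum_sum_min_reflect (N : ℕ) :
    6 * ∑ j ∈ Finset.range (N + 1), ∑ k ∈ Finset.range (N + 1), min (N - j) k =
      N * (N + 1) * (2 * N + 1) := by
  rw [← six_mul_sum_sum_min, Finset.sum_range_reflect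
    (fun j => ∑ k ∈ Finset.range (N + 1), min j k) (N + 1) |>.symm]
  simp

/-- A single coordinate of a uniformly random function is uniform. -/
theorem sum_fun_eval {ι α : Type*} [Fintype ι] [DecidableEq ι] [Fintype α] [Nonempty α]
    (i : ι) (G : α → ℝ) :
    (∑ e : ι → α, G (e i)) / (Fintype.card α : ℝ) ^ Fintype.card ι =
      (∑ a, G a) / Fintype.card α := by
  have hc : (Fintype.card α : ℝ) ≠ 0 := by exact_mod_cast Fintype.card_ne_zero
  rw [← Equiv.sum_comp (Equiv.funSplitAt i α).symm (fun e : ι → α => G (e i))]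
  simp only [Equiv.funSplitAt_symm_apply, dite_true, Fintype.sum_prod_type, Finset.sum_const,
    Finset.card_univ, nsmul_eq_mul, Fintype.card_fun, Fintype.card_subtype_compl,
    Fintype.card_subtype_eq]
  rw [← Finset.mul_sum, div_eq_div_iff (pow_ne_zero _ hc) hc]
  have : Fintype.card ι = Fintype.card ι - 1 + 1 := by
    have := Fintype.card_pos_iff.mpr ⟨i⟩
    omega
  nth_rewrite 2 [this]
  push_cast
  ring

/-- Two distinct coordinates of a uniformly random function are independent. -/
theorem sum_fun_eval₂ {ι α : Type*} [Fintype ι] [DecidableEq ι] [Fintype α] [Nonempty α]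
    {i j : ι} (hij : j ≠ i) (G : α → α → ℝ) :
    (∑ e : ι → α, G (e i) (e j)) / (Fintype.card α : ℝ) ^ Fintype.card ι =
      (∑ a, ∑ b, G a b) / (Fintype.card α : ℝ) ^ 2 := by
  have hc : (Fintype.card α : ℝ) ≠ 0 := by exact_mod_cast Fintype.card_ne_zero
  rw [← Equiv.sum_comp (Equiv.funSplitAt i α).symm (fun e : ι → α => G (e i) (e j))]
  simp only [Equiv.funSplitAt_symm_apply, dite_true, Fintype.sum_prod_type, dif_neg hij]
  have h := fun a => sum_fun_eval (ι := { k // k ≠ i }) ⟨j, hij⟩ (G a)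
  have hcard : Fintype.card { k // k ≠ i } + 1 = Fintype.card ι := by
    have := Fintype.card_pos_iff.mpr ⟨i⟩
    simp [Fintype.card_subtype_compl]
    omega
  rw [← hcard, pow_succ, ← div_div, Finset.sum_div, Finset.sum_congr rfl fun a _ => h a,
    ← Finset.sum_div, div_div, sq]

/-- The mean of `min (N - j) j` over `0 ≤ j ≤ N`. -/
noncomputable def selfMean (N : ℕ) : ℝ :=
  (∑ a : Fin (N + 1), ((min (N - a) a : ℕ) : ℝ)) / (N + 1 : ℕ)

/-- The mean of `min (N - j) k` over `0 ≤ j, k ≤ N`. -/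
noncomputable def pairMean (N : ℕ) : ℝ :=
  (∑ a : Fin (N + 1), ∑ b : Fin (N + 1), ((min (N - a) b : ℕ) : ℝ)) / ((N + 1 : ℕ) : ℝ) ^ 2

theorem selfMean_eq (N : ℕ) : selfMean N = ((N ^ 2 / 4 : ℕ) : ℝ) / (N + 1) := by
  rw [selfMean, Fin.sum_univ_eq_sum_range (fun a => ((min (N - a) a : ℕ) : ℝ)),
    ← sum_min_reflect]
  simp [min_comm]

theorem pairMean_eq (N : ℕ) : pairMean N = (N * (2 * N + 1) : ℝ) / (6 * (N + 1)) := by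
  have h := six_mul_sum_sum_min_reflect N
  have h' : (6 : ℝ) * ∑ j ∈ Finset.range (N + 1), ∑ k ∈ Finset.range (N + 1),
      ((min (N - j) k : ℕ) : ℝ) = N * (N + 1) * (2 * N + 1) := by exact_mod_cast h
  have h2 : ∀ a : ℕ, ∑ b : Fin (N + 1), ((min (N - a) b : ℕ) : ℝ) =
      ∑ k ∈ Finset.range (N + 1), ((min (N - a) k : ℕ) : ℝ) := fun a =>
    Fin.sum_univ_eq_sum_range (fun b => ((min (N - a) b : ℕ) : ℝ)) _
  rw [pairMean]
  simp only [h2]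
  rw [Fin.sum_univ_eq_sum_range
    (fun a => ∑ k ∈ Finset.range (N + 1), ((min (N - a) k : ℕ) : ℝ))]
  rw [div_eq_div_iff (by positivity) (by positivity)]
  push_cast at h' ⊢
  linear_combination (N + 1 : ℝ) * h'

theorem selfMean_one : selfMean 1 = 0 := by simp [selfMean_eq]

theorem selfMean_nonneg (N : ℕ) : 0 ≤ selfMean N := by
  rw [selfMean_eq]; positivity

/-- Equality holds at `N = 2` and `N = 3`; the bound fails at `N = 1`, where the mean is zero. -/
theorem div_six_le_selfMean {N : ℕ} (hN : 2 ≤ N) : (N : ℝ) / 6 ≤ selfMean N := by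
  rw [selfMean_eq, div_le_div_iff₀ (by positivity) (by positivity)]
  have h : N * (N + 1) ≤ N ^ 2 / 4 * 6 := by
    obtain ⟨k, rfl | rfl⟩ := N.even_or_odd'
    · have : (2 * k) ^ 2 / 4 = k ^ 2 := by
        rw [show (2 * k) ^ 2 = k ^ 2 * 4 by ring]; simp
      rw [this]
      nlinarith
    · have : (2 * k + 1) ^ 2 / 4 = k ^ 2 + k := by
        rw [show (2 * k + 1) ^ 2 = 1 + (k ^ 2 + k) * 4 by ring]; omega
      rw [this]
      have hk : 1 ≤ k := by omega
      nlinarith [Nat.mul_le_mul hk hk]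
  exact_mod_cast h

theorem selfMean_lt {N : ℕ} (hN : 0 < N) : selfMean N < (N : ℝ) / 3 := by
  rw [selfMean_eq, div_lt_div_iff₀ (by positivity) (by positivity)]
  have h : N ^ 2 / 4 * 3 < N * (N + 1) := by
    have := Nat.div_mul_le_self (N ^ 2) 4
    nlinarith
  exact_mod_cast h

/-- Clearing denominators leaves `3 * (N + 1) ≤ 2 * (2 * N + 1)`, an equality at `N = 1`. -/
theorem div_four_le_pairMean {N : ℕ} (hN : 0 < N) : (N : ℝ) / 4 ≤ pairMean N := by
  rw [pairMean_eq, div_le_div_iff₀ (by positivity) (by positivity)]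
  have : (1 : ℝ) ≤ N := by exact_mod_cast hN
  nlinarith

theorem pairMean_lt {N : ℕ} (hN : 0 < N) : pairMean N < (N : ℝ) / 3 := by
  rw [pairMean_eq, div_lt_div_iff₀ (by positivity) (by positivity)]
  have : (1 : ℝ) ≤ N := by exact_mod_cast hN
  nlinarith

/-! ### Arithmetic of `M_q` -/

theorem oddGoodIntegers_of_dvd {q a b : ℕ} (hab : a ∣ b) (hb : b ∈ oddGoodIntegers q) :
    a ∈ oddGoodIntegers q := by
  obtain ⟨h1, i, hi, hd⟩ := hb
  exact ⟨Nat.pos_of_dvd_of_pos hab h1, i, hi, hab.trans hd⟩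

theorem one_mem_oddGoodIntegers (q : ℕ) : 1 ∈ oddGoodIntegers q :=
  ⟨le_rfl, 1, odd_one, one_dvd _⟩

theorem pow_add_one_dvd_pow_mul_add_one (q i : ℕ) {j : ℕ} (hj : Odd j) :
    q ^ i + 1 ∣ q ^ (i * j) + 1 := by
  simpa [pow_mul] using hj.nat_add_dvd_pow_add_pow (q ^ i) 1

theorem lcm_mem_oddGoodIntegers {q a b : ℕ} (ha : a ∈ oddGoodIntegers q)
    (hb : b ∈ oddGoodIntegers q) : a.lcm b ∈ oddGoodIntegers q := by
  obtain ⟨ha1, i, hi, hai⟩ := ha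
  obtain ⟨hb1, j, hj, hbj⟩ := hb
  refine ⟨Nat.lcm_pos ha1 hb1, i * j, hi.mul hj, Nat.lcm_dvd ?_ ?_⟩
  · exact hai.trans (pow_add_one_dvd_pow_mul_add_one q i hj)
  · exact hbj.trans (mul_comm j i ▸ pow_add_one_dvd_pow_mul_add_one q j hi)

/-- If an odd `r` divides `a + 1`, then `r * (a + 1)` divides `a ^ r + 1`. -/
theorem mul_add_one_dvd_pow_add_one {a r : ℕ} (hr : Odd r) (h : r ∣ a + 1) :
    r * (a + 1) ∣ a ^ r + 1 := by
  zify at h ⊢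
  have h1 : ((-a : ℤ)) ^ r - 1 = (∑ i ∈ Finset.range r, (-a : ℤ) ^ i) * (-a - 1) :=
    (geom_sum_mul _ _).symm
  -- Modulo `r` every `(-a) ^ i` is `1`, so the cofactor of `a + 1` is congruent to `r`.
  have h2 : (r : ℤ) ∣ ∑ i ∈ Finset.range r, (-a : ℤ) ^ i := by
    rw [← Int.modEq_zero_iff_dvd]
    have h3 : (-a : ℤ) ≡ 1 [ZMOD r] := by
      rw [Int.modEq_iff_dvd]
      simpa [add_comm] using h
    calc ∑ i ∈ Finset.range r, (-a : ℤ) ^ i ≡ ∑ i ∈ Finset.range r, 1 [ZMOD r] :=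
          Int.ModEq.sum fun i _ => by simpa using h3.pow i
      _ ≡ 0 [ZMOD r] := by simp
  rw [hr.neg_pow] at h1
  have h4 : (a : ℤ) ^ r + 1 = (∑ i ∈ Finset.range r, (-a : ℤ) ^ i) * (a + 1) := by linarith
  rw [h4]
  exact mul_dvd_mul_right h2 _

/-- For odd `q` the cofactor of `q + 1` in `q ^ i + 1` is a sum of `i` odd terms, hence odd, and the
full power of 2 sits in `q + 1`. -/
theorem pow_two_dvd_add_one_of_dvd_pow_add_one {q i k : ℕ} (hi : Odd i)
    (h : 2 ^ k ∣ q ^ i + 1) : 2 ^ k ∣ q + 1 := by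
  rcases Nat.eq_zero_or_pos k with rfl | hk
  · simp
  have hq : Odd q := by
    by_contra hq
    have h2 : 2 ∣ q ^ i + 1 := (dvd_pow_self 2 hk.ne').trans h
    have h3 : Even (q ^ i) := (Nat.not_odd_iff_even.mp hq).pow_of_ne_zero hi.pos.ne'
    exact (Nat.not_even_iff_odd.mpr h3.add_one) (even_iff_two_dvd.mpr h2)
  zify at h ⊢
  have h1 : ((-q : ℤ)) ^ i - 1 = (∑ i ∈ Finset.range i, (-q : ℤ) ^ i) * (-q - 1) :=
    (geom_sum_mul _ _).symm
  rw [hi.neg_pow] at h1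
  have h4 : (q : ℤ) ^ i + 1 = (∑ i ∈ Finset.range i, (-q : ℤ) ^ i) * (q + 1) := by linarith
  have hodd : Odd (∑ i ∈ Finset.range i, (-q : ℤ) ^ i) := by
    have hq' : (-q : ℤ) ≡ 1 [ZMOD 2] :=
      Int.odd_iff.mp (show Odd (q : ℤ) from by exact_mod_cast hq).neg
    have h5 : ∑ j ∈ Finset.range i, (-q : ℤ) ^ j ≡ ∑ j ∈ Finset.range i, 1 [ZMOD 2] :=
      Int.ModEq.sum fun j _ => by simpa using hq'.pow j
    rw [Int.odd_iff, h5.eq, ← Int.odd_iff]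
    simpa using hi
  rw [h4] at h
  refine IsCoprime.dvd_of_dvd_mul_left ?_ h
  exact (Int.isCoprime_two_left.mpr hodd).pow_left

theorem padicValNat_two_le_of_mem_oddGoodIntegers {q γ l : ℕ} (hγ : ¬ 2 ^ (γ + 1) ∣ q + 1)
    (hl : l ∈ oddGoodIntegers q) : padicValNat 2 l ≤ γ := by
  obtain ⟨h1, i, hi, hd⟩ := hl
  by_contra! h
  exact hγ (pow_two_dvd_add_one_of_dvd_pow_add_one hi
    (((pow_dvd_pow 2 h).trans pow_padicValNat_dvd).trans hd))

theorem two_pow_mem_oddGoodIntegers {q γ k : ℕ} (hγ : 2 ^ γ ∣ q + 1) (hk : k ≤ γ) :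
    2 ^ k ∈ oddGoodIntegers q :=
  ⟨Nat.one_le_two_pow, 1, odd_one, by simpa using (pow_dvd_pow 2 hk).trans hγ⟩

theorem odd_mul_mem_oddGoodIntegers {q r l : ℕ} (hr : Odd r) (hrq : r ∣ q + 1)
    (hl : l ∈ oddGoodIntegers q) : r * l ∈ oddGoodIntegers q := by
  obtain ⟨h1, i, hi, hd⟩ := hl
  have h2 : r ∣ q ^ i + 1 := hrq.trans (by simpa using pow_add_one_dvd_pow_mul_add_one q 1 hi)
  refine ⟨Nat.mul_pos hr.pos h1, i * r, hi.mul hr, ?_⟩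
  rw [pow_mul]
  exact (mul_dvd_mul_left r hd).trans (mul_add_one_dvd_pow_add_one hr h2)

theorem exists_odd_eq_two_pow_padicValNat_mul {a : ℕ} (ha : a ≠ 0) :
    ∃ b, Odd b ∧ a = 2 ^ padicValNat 2 a * b := by
  obtain ⟨k, b, hb, h⟩ := Nat.exists_eq_two_pow_mul_odd ha
  refine ⟨b, hb, ?_⟩
  have : padicValNat 2 a = k := by
    rw [h, padicValNat.mul (by positivity) (by rintro rfl; simp at hb), padicValNat.prime_pow,
      padicValNat.eq_zero_of_not_dvd hb.not_two_dvd_nat, add_zero]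
  rwa [this]

/-- The odd part of `r * l` is good because an odd divisor of `q + 1` may be multiplied in freely;
the 2-part divides `q + 1`. The two are coprime, so their lcm is `r * l`. -/
theorem mul_mem_oddGoodIntegers {q γ r l : ℕ} (hγ : 2 ^ γ ∣ q + 1) (hr : r ∣ q + 1)
    (hl : l ∈ oddGoodIntegers q) (h : padicValNat 2 l + padicValNat 2 r ≤ γ) :
    r * l ∈ oddGoodIntegers q := by
  have hr0 : r ≠ 0 := by rintro rfl; simp at hr
  have hl0 : l ≠ 0 := by have := hl.1; omega
  obtain ⟨r', hr', hrr⟩ := exists_odd_eq_two_pow_padicValNat_mul hr0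
  obtain ⟨l', hl', hll⟩ := exists_odd_eq_two_pow_padicValNat_mul hl0
  have h1 : r' * l' ∈ oddGoodIntegers q :=
    odd_mul_mem_oddGoodIntegers hr' ((Dvd.intro_left _ hrr.symm).trans hr)
      (oddGoodIntegers_of_dvd (Dvd.intro_left _ hll.symm) hl)
  have h2 := lcm_mem_oddGoodIntegers (two_pow_mem_oddGoodIntegers hγ h) h1
  rw [Nat.Coprime.lcm_eq_mul
    (Nat.Coprime.pow_left _ (Nat.coprime_two_left.mpr (hr'.mul hl')))] at h2
  convert h2 using 1
  conv_lhs => rw [hrr, hll]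
  ring

/-! ### Constacyclic codes as ideals modulo `X ^ n - C lam` -/

section Codes

variable {F : Type*} [Field F] {n : ℕ}

/-- The constacyclic shift as a linear map. -/
def shiftMap (n : ℕ) (lam : F) : (Fin n → F) →ₗ[F] (Fin n → F) where
  toFun := constacyclicShift lam
  map_add' u v := by
    ext i
    simp only [constacyclicShift, Pi.add_apply]
    split_ifs <;> ring
  map_smul' c v := by
    ext i
    simp only [constacyclicShift, Pi.smul_apply, smul_eq_mul, RingHom.id_apply]
    split_ifs <;> ring

theorem shiftMap_single_of_lt (lam : F) {i : ℕ} (hi : i + 1 < n) :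
    shiftMap n lam (Pi.single ⟨i, by omega⟩ 1) = Pi.single ⟨i + 1, hi⟩ 1 := by
  ext j
  simp only [shiftMap, LinearMap.coe_mk, AddHom.coe_mk, constacyclicShift, Pi.single_apply,
    Fin.ext_iff]
  split_ifs <;> first | omega | simp

/-- The constacyclic code generated by `g`. -/
noncomputable def polyCode (n : ℕ) (lam : F) (g : F[X]) : Submodule F (Fin n → F) :=
  LinearMap.range (aeval (shiftMap n lam) g)

theorem polyCode_mem_constacyclicCodes (lam : F) (g : F[X]) :
    polyCode n lam g ∈ constacyclicCodes n lam := by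
  rintro _ ⟨w, rfl⟩
  refine ⟨shiftMap n lam w, ?_⟩
  change _ = shiftMap n lam _
  have h : ∀ a b : F[X], aeval (shiftMap n lam) a (aeval (shiftMap n lam) b w) =
      aeval (shiftMap n lam) (a * b) w := fun a b => by simp
  have h1 := h g X
  have h2 := h X g
  rw [mul_comm, ← h2] at h1
  simpa using h1

variable [NeZero n]

theorem shiftMap_single_last (lam : F) :
    shiftMap n lam (Pi.single ⟨n - 1, Nat.sub_one_lt (NeZero.ne n)⟩ 1) = lam • Pi.single 0 1 := by
  ext j
  simp only [shiftMap, LinearMap.coe_mk, AddHom.coe_mk, constacyclicShift, Pi.single_apply,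
    Fin.ext_iff, Pi.smul_apply, Fin.val_zero]
  have := j.isLt
  split_ifs <;> first | omega | simp

/-- The linear map sending a polynomial to the coefficient vector of its residue modulo
`X ^ n - C lam`. -/
noncomputable def residueVec (n : ℕ) [NeZero n] (lam : F) : F[X] →ₗ[F] (Fin n → F) :=
  LinearMap.applyₗ (Pi.single 0 1) ∘ₗ (aeval (shiftMap n lam)).toLinearMap

theorem residueVec_apply (lam : F) (h : F[X]) :
    residueVec n lam h = aeval (shiftMap n lam) h (Pi.single 0 1) := rfl

theorem residueVec_mul (lam : F) (a b : F[X]) :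
    residueVec n lam (a * b) = aeval (shiftMap n lam) a (residueVec n lam b) := by
  simp [residueVec_apply]

theorem residueVec_X_pow (lam : F) {i : ℕ} (hi : i < n) :
    residueVec n lam (X ^ i) = Pi.single ⟨i, hi⟩ 1 := by
  induction i with
  | zero => simp [residueVec_apply]
  | succ i ih =>
    rw [pow_succ', residueVec_mul, ih (by omega), aeval_X, shiftMap_single_of_lt]

theorem residueVec_X_pow_self (lam : F) :
    residueVec n lam (X ^ n) = lam • Pi.single 0 1 := by
  have : X ^ n = (X * X ^ (n - 1) : F[X]) := by
    rw [← pow_succ', Nat.sub_add_cancel (NeZero.pos n)]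
  rw [this, residueVec_mul, aeval_X, residueVec_X_pow lam (Nat.sub_one_lt (NeZero.ne n)),
    shiftMap_single_last]

theorem residueVec_modulus_mul (lam : F) (a : F[X]) :
    residueVec n lam ((X ^ n - C lam) * a) = 0 := by
  have h : residueVec n lam (X ^ n - C lam) = 0 := by
    rw [map_sub, residueVec_X_pow_self, residueVec_apply, aeval_C]
    simp [Module.algebraMap_end_apply]
  rw [mul_comm, residueVec_mul, h, map_zero]

theorem residueVec_apply_of_degree_lt (lam : F) {h : F[X]} (hd : h.degree < n) (i : Fin n) :
    residueVec n lam h i = h.coeff i := by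
  have h1 : h = ∑ j : Fin n, h.coeff j • (X : F[X]) ^ (j : ℕ) := by
    rw [Fin.sum_univ_eq_sum_range (fun j => h.coeff j • (X : F[X]) ^ j)]
    have hd' : h.natDegree < n := by
      rcases eq_or_ne h 0 with rfl | h0
      · simpa using NeZero.pos n
      · exact (natDegree_lt_iff_degree_lt h0).mpr hd
    conv_lhs => rw [h.as_sum_range' n hd']
    simp [smul_eq_C_mul, C_mul_X_pow_eq_monomial]
  conv_lhs => rw [h1]
  simp only [map_sum, map_smul, residueVec_X_pow lam (Fin.isLt _), Finset.sum_apply,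
    Pi.smul_apply, Pi.single_apply, smul_eq_mul]
  simp

theorem residueVec_eq_zero_iff (lam : F) (h : F[X]) :
    residueVec n lam h = 0 ↔ X ^ n - C lam ∣ h := by
  refine ⟨fun h0 => ?_, ?_⟩
  · have hm : (X ^ n - C lam : F[X]).Monic := monic_X_pow_sub_C lam (NeZero.ne n)
    rw [← modByMonic_eq_zero_iff_dvd hm]
    have hd : (h %ₘ (X ^ n - C lam)).degree < n := by
      simpa [degree_X_pow_sub_C (NeZero.pos n)] using degree_modByMonic_lt h hm
    have h1 : residueVec n lam (h %ₘ (X ^ n - C lam)) = 0 := by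
      rw [modByMonic_eq_sub_mul_div, map_sub, residueVec_modulus_mul, h0, sub_zero]
    ext i
    rcases lt_or_ge i n with hi | hi
    · have := residueVec_apply_of_degree_lt lam hd ⟨i, hi⟩
      rw [h1] at this
      simpa using this.symm
    · rw [coeff_eq_zero_of_degree_lt (hd.trans_le (by exact_mod_cast hi)), coeff_zero]
  · rintro ⟨a, rfl⟩
    exact residueVec_modulus_mul lam a

theorem residueVec_surjective (lam : F) : Function.Surjective (residueVec n lam) := by
  intro v
  refine ⟨∑ j : Fin n, v j • (X : F[X]) ^ (j : ℕ), ?_⟩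
  ext i
  simp only [map_sum, map_smul, residueVec_X_pow lam (Fin.isLt _), Finset.sum_apply,
    Pi.smul_apply, Pi.single_apply, smul_eq_mul]
  simp

theorem residueVec_mem_polyCode_iff {lam : F} {g : F[X]} (hg : g ∣ X ^ n - C lam) (a : F[X]) :
    residueVec n lam a ∈ polyCode n lam g ↔ g ∣ a := by
  constructor
  · rintro ⟨w, hw⟩
    obtain ⟨b, rfl⟩ := residueVec_surjective lam w
    rw [← residueVec_mul] at hw
    have h : residueVec n lam (g * b - a) = 0 := by rw [map_sub, hw, sub_self]
    exact (dvd_sub_right (dvd_mul_right g b)).mp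
      (hg.trans ((residueVec_eq_zero_iff lam _).mp h))
  · rintro ⟨b, rfl⟩
    rw [residueVec_mul]
    exact ⟨_, rfl⟩

/-- The polynomials whose residue vector lies in `D` form an ideal of `F[X]`, which is principal and
contains the modulus. -/
theorem exists_polyCode_eq {lam : F} {D : Submodule F (Fin n → F)}
    (hD : D ∈ constacyclicCodes n lam) :
    ∃ g : F[X], g ∣ X ^ n - C lam ∧ polyCode n lam g = D := by
  have hmem : ∀ (a : F[X]) (v : Fin n → F), v ∈ D → aeval (shiftMap n lam) a v ∈ D := by
    intro a v hv
    induction a using Polynomial.induction_on' with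
    | add a b ha hb => simpa using D.add_mem ha hb
    | monomial k c =>
      rw [aeval_monomial, Module.End.mul_apply, Module.algebraMap_end_apply]
      refine D.smul_mem c ?_
      induction k with
      | zero => simpa
      | succ k ih =>
        rw [pow_succ', Module.End.mul_apply]
        exact hD _ ih
  let I : Ideal F[X] :=
    { carrier := {a | residueVec n lam a ∈ D}
      add_mem' := fun {a b} ha hb => by
        simp only [Set.mem_ofPred_eq, map_add] at *
        exact D.add_mem ha hb
      zero_mem' := by simp
      smul_mem' := fun c a ha => by
        simp only [Set.mem_ofPred_eq, smul_eq_mul, residueVec_mul] at *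
        exact hmem _ _ ha }
  obtain ⟨g, hg⟩ := (IsPrincipalIdealRing.principal I).principal
  have hI : ∀ a, residueVec n lam a ∈ D ↔ g ∣ a := by
    intro a
    rw [← Ideal.mem_span_singleton, Ideal.span, ← hg]
    rfl
  have hgP : g ∣ X ^ n - C lam := by
    rw [← hI, (residueVec_eq_zero_iff lam _).mpr dvd_rfl]
    exact D.zero_mem
  refine ⟨g, hgP, ?_⟩
  ext v
  obtain ⟨a, rfl⟩ := residueVec_surjective lam v
  rw [residueVec_mem_polyCode_iff hgP, hI]

/-- The quotient of `Fin n → F` by the code is `F[X] / (g)`, of dimension `g.natDegree`. -/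
theorem finrank_polyCode {lam : F} {g : F[X]} (hg : g ∣ X ^ n - C lam) :
    Module.finrank F (polyCode n lam g) + g.natDegree = n := by
  let φ : F[X] →ₗ[F] ((Fin n → F) ⧸ polyCode n lam g) :=
    (polyCode n lam g).mkQ ∘ₗ residueVec n lam
  have hφ : Function.Surjective φ :=
    (Submodule.mkQ_surjective _).comp (residueVec_surjective lam)
  have hker : LinearMap.ker φ = (Ideal.span {g}).restrictScalars F := by
    ext a
    simp [φ, Ideal.mem_span_singleton, residueVec_mem_polyCode_iff hg]
  have h1 := (LinearMap.quotKerEquivOfSurjective φ hφ).finrank_eq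
  rw [hker, (Submodule.Quotient.restrictScalarsEquiv F (Ideal.span {g})).finrank_eq] at h1
  rw [← finrank_quotient_span_eq_natDegree (f := g)]
  have h2 := Submodule.finrank_quotient_add_finrank (polyCode n lam g)
  rw [← h1] at h2
  simpa [add_comm] using h2

end Codes

/-! ### Hermitian duals through conjugate reciprocals -/

section Hermitian

variable {F : Type*} [Field F] {n : ℕ} [NeZero n]

/-- The `σ`-conjugate reciprocal polynomial. -/
noncomputable def conjReverse (σ : F →+* F) (g : F[X]) : F[X] := g.reverse.map σ

theorem sum_shiftMap_mul_pow {lam : F} {q : ℕ} (hlam : lam ^ (q + 1) = 1) (u v : Fin n → F) :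
    ∑ i, shiftMap n lam u i * shiftMap n lam v i ^ q = ∑ i, u i * v i ^ q := by
  obtain ⟨k, rfl⟩ := Nat.exists_eq_succ_of_ne_zero (NeZero.ne n)
  rw [Fin.sum_univ_succ, Fin.sum_univ_castSucc]
  have h0 : ∀ w : Fin (k + 1) → F, shiftMap (k + 1) lam w 0 = lam * w (Fin.last k) :=
    fun w => rfl
  have h1 : ∀ (w : Fin (k + 1) → F) (j : Fin k),
      shiftMap (k + 1) lam w j.succ = w j.castSucc := fun w j => rfl
  simp only [h0, h1]
  rw [pow_succ] at hlam
  rw [mul_pow, add_comm]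
  linear_combination (u (Fin.last k) * v (Fin.last k) ^ q) * hlam

theorem sum_shiftMap_pow_mul_pow {lam : F} {q : ℕ} (hlam : lam ^ (q + 1) = 1) (k : ℕ)
    (u v : Fin n → F) :
    ∑ i, (shiftMap n lam ^ k) u i * (shiftMap n lam ^ k) v i ^ q = ∑ i, u i * v i ^ q := by
  induction k with
  | zero => simp
  | succ k ih =>
    rw [pow_succ']
    simp only [Module.End.mul_apply]
    rw [sum_shiftMap_mul_pow hlam, ih]

/-- The shift `T` preserves the Hermitian form as `lam ^ (q + 1) = 1`, so its adjoint is its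
inverse. Applying `T ^ (d - j)` to both arguments of the `j`-th term clears the negative powers and
reverses the coefficients. -/
theorem sum_mul_aeval_pow {lam : F} {q : ℕ} (hlam : lam ^ (q + 1) = 1) {σ : F →+* F}
    (hσ : ∀ x, σ x = x ^ q) (g : F[X]) (u v : Fin n → F) :
    ∑ i, u i * (aeval (shiftMap n lam) g v) i ^ q =
      ∑ i, (aeval (shiftMap n lam) (conjReverse σ g) u) i *
        ((shiftMap n lam ^ g.natDegree) v) i ^ q := by
  set T := shiftMap n lam
  set d := g.natDegree
  have hconj : conjReverse σ g = ∑ j ∈ Finset.range (d + 1), C (σ (g.coeff j)) * X ^ (d - j) := by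
    ext m
    simp only [conjReverse, coeff_map, coeff_reverse, finsetSum_coeff, coeff_C_mul, coeff_X_pow]
    rcases le_or_gt m d with hm | hm
    · rw [revAt_le hm, Finset.sum_eq_single (d - m)]
      · simp [show d - (d - m) = m by omega]
      · intro b hb hne
        have := Finset.mem_range.mp hb
        rw [if_neg (by omega), mul_zero]
      · intro h
        exact absurd (Finset.mem_range.mpr (by omega)) h
    · rw [revAt_eq_self_of_lt hm, coeff_eq_zero_of_natDegree_lt hm, map_zero]
      refine (Finset.sum_eq_zero fun b hb => ?_).symm
      rw [if_neg (by omega), mul_zero]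
  have hterm : ∀ j ∈ Finset.range (d + 1),
      ∑ i, u i * (g.coeff j • (T ^ j) v i) ^ q =
        ∑ i, (σ (g.coeff j) • (T ^ (d - j)) u i) * ((T ^ d) v) i ^ q := by
    intro j hj
    have hjd : d - j + j = d := by have := Finset.mem_range.mp hj; omega
    have h1 := sum_shiftMap_pow_mul_pow hlam (d - j) u ((T ^ j) v)
    rw [← Module.End.mul_apply, ← pow_add, hjd] at h1
    simp only [smul_eq_mul, mul_pow, hσ]
    calc _ = g.coeff j ^ q * ∑ i, u i * (T ^ j) v i ^ q := by
          rw [Finset.mul_sum]; exact Finset.sum_congr rfl fun i _ => by ring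
      _ = _ := by
          rw [← h1, Finset.mul_sum]; exact Finset.sum_congr rfl fun i _ => by ring
  have hL : ∀ i, (aeval T g v) i = ∑ j ∈ Finset.range (d + 1), g.coeff j • (T ^ j) v i := by
    intro i
    rw [aeval_eq_sum_range]
    simp [d, LinearMap.sum_apply, Finset.sum_apply]
  have hR : ∀ i, (aeval T (conjReverse σ g) u) i =
      ∑ j ∈ Finset.range (d + 1), σ (g.coeff j) • (T ^ (d - j)) u i := by
    intro i
    rw [hconj]
    simp [LinearMap.sum_apply, Finset.sum_apply, Module.algebraMap_end_apply]
  simp only [hL, hR, ← hσ, map_sum, Finset.mul_sum, Finset.sum_mul]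
  simp only [hσ]
  rw [Finset.sum_comm, Finset.sum_congr rfl hterm, Finset.sum_comm]
  simp only [hσ]

theorem shiftMap_pow_surjective {lam : F} (hlam : lam ≠ 0) (k : ℕ) :
    Function.Surjective (shiftMap n lam ^ k) := by
  have h : Function.Injective (shiftMap n lam) := by
    rw [injective_iff_map_eq_zero]
    intro v hv
    obtain ⟨m, rfl⟩ := Nat.exists_eq_succ_of_ne_zero (NeZero.ne n)
    ext i
    refine Fin.lastCases ?_ (fun j => ?_) i
    · have : lam * v (Fin.last m) = 0 := congrFun hv 0
      simpa [hlam] using this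
    · exact congrFun hv j.succ
  rw [Module.End.coe_pow]
  exact (LinearMap.surjective_of_injective h).iterate k

theorem residueVec_mem_hermitianDual_iff {lam : F} {q : ℕ} (hlam : lam ^ (q + 1) = 1)
    {σ : F →+* F} (hσ : ∀ x, σ x = x ^ q) (hσs : q ≠ 0) (g a : F[X]) :
    residueVec n lam a ∈ hermitianDual q (polyCode n lam g) ↔
      X ^ n - C lam ∣ conjReverse σ g * a := by
  have hlam0 : lam ≠ 0 := by rintro rfl; simp at hlam
  rw [← residueVec_eq_zero_iff, residueVec_mul]
  constructor
  · intro h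
    ext i
    -- Testing against a vector shifted onto the `i`-th basis vector isolates coordinate `i`.
    obtain ⟨v, hv⟩ := shiftMap_pow_surjective hlam0 g.natDegree (Pi.single i (1 : F))
    have h1 := h _ ⟨v, rfl⟩
    rw [sum_mul_aeval_pow hlam hσ, hv, Finset.sum_eq_single i] at h1
    · simpa using h1
    · intro j _ hj
      simp [hj, hσs]
    · simp
  · rintro h _ ⟨v, rfl⟩
    rw [sum_mul_aeval_pow hlam hσ, h]
    simp

end Hermitian

/-! ### Divisibility among products of powers of coprime irreducibles -/

section PrimePowerProducts

variable {F ι : Type*} [Field F] {f : ι → F[X]}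

theorem exists_associated_prod_pow (hirr : ∀ i, Irreducible (f i)) (N : ℕ) (s : Finset ι)
    {g : F[X]} (hg : g ∣ ∏ i ∈ s, f i ^ N) :
    ∃ e : ι → ℕ, (∀ i, e i ≤ N) ∧ Associated g (∏ i ∈ s, f i ^ e i) := by
  classical
  induction s using Finset.induction_on generalizing g with
  | empty =>
    refine ⟨fun _ => 0, fun _ => Nat.zero_le _, ?_⟩
    simpa [associated_one_iff_isUnit, isUnit_iff_dvd_one] using hg
  | insert i s hi ih =>
    rw [Finset.prod_insert hi] at hg
    obtain ⟨a, b, ha, hb, rfl⟩ := exists_dvd_and_dvd_of_dvd_mul hg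
    obtain ⟨e, he, hbe⟩ := ih hb
    obtain ⟨k, hk, hak⟩ := (dvd_prime_pow (hirr i).prime N).mp ha
    refine ⟨Function.update e i k, fun j => ?_, ?_⟩
    · rcases eq_or_ne j i with rfl | hj
      · simpa using hk
      · simpa [hj] using he j
    · rw [Finset.prod_insert hi, Function.update_self]
      have : ∏ j ∈ s, f j ^ Function.update e i k j = ∏ j ∈ s, f j ^ e j :=
        Finset.prod_congr rfl fun j hj => by
          rw [Function.update_of_ne (ne_of_mem_of_not_mem hj hi)]
      rw [this]
      exact hak.mul_mul hbe

variable [Fintype ι]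

theorem pow_dvd_prod_pow_mul_iff (hirr : ∀ i, Irreducible (f i))
    (hcop : Pairwise fun i j => IsCoprime (f i) (f j)) (e : ι → ℕ) (i : ι) (k : ℕ) (a : F[X]) :
    f i ^ k ∣ (∏ j, f j ^ e j) * a ↔ f i ^ (k - e i) ∣ a := by
  classical
  rw [← Finset.mul_prod_erase _ _ (Finset.mem_univ i), mul_assoc]
  rcases le_total k (e i) with h | h
  · rw [Nat.sub_eq_zero_of_le h, pow_zero]
    exact iff_of_true (Dvd.dvd.mul_right (pow_dvd_pow _ h) _) (one_dvd _)
  · obtain ⟨m, rfl⟩ := Nat.exists_eq_add_of_le h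
    rw [Nat.add_sub_cancel_left, pow_add, mul_dvd_mul_iff_left (pow_ne_zero _ (hirr i).ne_zero)]
    refine ⟨fun h => IsCoprime.dvd_of_dvd_mul_left ?_ h, fun h => h.mul_left _⟩
    exact IsCoprime.prod_right fun j hj => (hcop (Finset.ne_of_mem_erase hj).symm).pow

theorem prod_pow_dvd_iff (hcop : Pairwise fun i j => IsCoprime (f i) (f j)) (e : ι → ℕ)
    (a : F[X]) : ∏ j, f j ^ e j ∣ a ↔ ∀ j, f j ^ e j ∣ a := by
  refine ⟨fun h j => ?_, fun h => ?_⟩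
  · exact (Finset.dvd_prod_of_mem (fun j => f j ^ e j) (Finset.mem_univ j)).trans h
  · refine Finset.prod_dvd_of_coprime (fun i _ j _ hij => ?_) fun j _ => h j
    exact IsCoprime.pow (hcop hij)

theorem pow_dvd_prod_pow_iff (hirr : ∀ i, Irreducible (f i))
    (hcop : Pairwise fun i j => IsCoprime (f i) (f j)) (e : ι → ℕ) (i : ι) (k : ℕ) :
    f i ^ k ∣ ∏ j, f j ^ e j ↔ k ≤ e i := by
  have h := pow_dvd_prod_pow_mul_iff hirr hcop e i k 1
  rw [mul_one] at h
  rw [h, ← isUnit_iff_dvd_one, isUnit_pow_iff_of_not_isUnit (hirr i).not_isUnit,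
    Nat.sub_eq_zero_iff_le]

end PrimePowerProducts

/-! ### The hull of a code and the average over exponent vectors -/

section Average

variable {F : Type*} [Field F] {n : ℕ}

theorem conjReverse_mul (σ : F →+* F) (a b : F[X]) :
    conjReverse σ (a * b) = conjReverse σ a * conjReverse σ b := by
  simp [conjReverse, reverse_mul_of_domain]

theorem conjReverse_one (σ : F →+* F) : conjReverse σ 1 = 1 := by
  rw [conjReverse, ← C_1, reverse_C]
  simp

/-- `conjReverse` as a monoid homomorphism. -/
noncomputable def conjReverseHom (σ : F →+* F) : F[X] →* F[X] where
  toFun := conjReverse σ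
  map_one' := conjReverse_one σ
  map_mul' := conjReverse_mul σ

theorem polyCode_eq_of_associated [NeZero n] {lam : F} {a b : F[X]} (ha : a ∣ X ^ n - C lam)
    (hab : Associated a b) : polyCode n lam a = polyCode n lam b := by
  ext v
  obtain ⟨c, rfl⟩ := residueVec_surjective lam v
  rw [residueVec_mem_polyCode_iff ha, residueVec_mem_polyCode_iff (hab.dvd'.trans ha),
    hab.dvd_iff_dvd_left]

variable {ι : Type*} [Fintype ι] {f : ι → F[X]} {lam : F} {q N : ℕ} {σ : F →+* F} {τ : ι → ι}

theorem associated_conjReverse_prod_pow (hτ : Function.Involutive τ)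
    (hconj : ∀ i, Associated (conjReverse σ (f i)) (f (τ i))) (e : ι → ℕ) :
    Associated (conjReverse σ (∏ i, f i ^ e i)) (∏ i, f i ^ e (τ i)) := by
  have h1 : conjReverse σ (∏ i, f i ^ e i) = ∏ i, conjReverse σ (f i) ^ e i := by
    change conjReverseHom σ _ = ∏ i, conjReverseHom σ (f i) ^ e i
    simp
  have h2 : ∏ i, f i ^ e (τ i) = ∏ i, f (τ i) ^ e i := by
    rw [← Equiv.prod_comp hτ.toPerm]
    simp [hτ _]
  rw [h1, h2]
  exact Associated.prod _ _ _ fun i _ => (hconj i).pow_pow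

variable [NeZero n]

/-- At each `f i`, membership in the code asks for exponent `e i`, and in the dual for the `N - e (τ
i)` missing from the conjugate reciprocal generator. The intersection takes the larger. -/
theorem hermitianHull_polyCode_prod_pow (hirr : ∀ i, Irreducible (f i))
    (hcop : Pairwise fun i j => IsCoprime (f i) (f j)) (hP : ∏ i, f i ^ N = X ^ n - C lam)
    (hlam : lam ^ (q + 1) = 1) (hσ : ∀ x, σ x = x ^ q) (hq : q ≠ 0)
    (hτ : Function.Involutive τ) (hconj : ∀ i, Associated (conjReverse σ (f i)) (f (τ i)))
    {e : ι → ℕ} (he : ∀ i, e i ≤ N) :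
    hermitianHull q (polyCode n lam (∏ i, f i ^ e i)) =
      polyCode n lam (∏ i, f i ^ max (e i) (N - e (τ i))) := by
  have hdvd : ∀ e : ι → ℕ, (∀ i, e i ≤ N) → ∏ i, f i ^ e i ∣ X ^ n - C lam := fun e he => by
    rw [← hP]
    exact Finset.prod_dvd_prod_of_dvd _ _ fun i _ => pow_dvd_pow _ (he i)
  ext v
  obtain ⟨a, rfl⟩ := residueVec_surjective lam v
  rw [hermitianHull, Submodule.mem_inf, residueVec_mem_polyCode_iff (hdvd e he),
    residueVec_mem_polyCode_iff (hdvd _ fun i => max_le (he i) (Nat.sub_le _ _)),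
    residueVec_mem_hermitianDual_iff hlam hσ hq,
    ((associated_conjReverse_prod_pow hτ hconj e).mul_right a).dvd_iff_dvd_right, ← hP,
    prod_pow_dvd_iff hcop, prod_pow_dvd_iff hcop, prod_pow_dvd_iff hcop, ← forall_and]
  refine forall_congr' fun i => ?_
  rw [pow_dvd_prod_pow_mul_iff hirr hcop]
  rcases le_total (e i) (N - e (τ i)) with h | h
  · rw [max_eq_right h]
    exact and_iff_right_of_imp (pow_dvd_pow _ h).trans
  · rw [max_eq_left h]
    exact and_iff_left_of_imp (pow_dvd_pow _ h).trans

theorem finrank_hermitianHull_polyCode_prod_pow (hirr : ∀ i, Irreducible (f i))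
    (hcop : Pairwise fun i j => IsCoprime (f i) (f j)) (hP : ∏ i, f i ^ N = X ^ n - C lam)
    (hlam : lam ^ (q + 1) = 1) (hσ : ∀ x, σ x = x ^ q) (hq : q ≠ 0)
    (hτ : Function.Involutive τ) (hconj : ∀ i, Associated (conjReverse σ (f i)) (f (τ i)))
    {e : ι → ℕ} (he : ∀ i, e i ≤ N) :
    Module.finrank F (hermitianHull q (polyCode n lam (∏ i, f i ^ e i))) =
      ∑ i, (f i).natDegree * min (N - e i) (e (τ i)) := by
  have hdeg : ∀ e : ι → ℕ, (∏ i, f i ^ e i).natDegree = ∑ i, e i * (f i).natDegree := fun e => by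
    rw [natDegree_prod _ _ fun i _ => pow_ne_zero _ (hirr i).ne_zero]
    simp
  have hle : ∀ i, max (e i) (N - e (τ i)) ≤ N := fun i => max_le (he i) (Nat.sub_le _ _)
  have hdvd : ∏ i, f i ^ max (e i) (N - e (τ i)) ∣ X ^ n - C lam := by
    rw [← hP]
    exact Finset.prod_dvd_prod_of_dvd _ _ fun i _ => pow_dvd_pow _ (hle i)
  have h1 := finrank_polyCode hdvd
  have h2 : ∑ i, N * (f i).natDegree = n := by
    rw [← hdeg, hP, natDegree_X_pow_sub_C]
  rw [hdeg] at h1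
  rw [hermitianHull_polyCode_prod_pow hirr hcop hP hlam hσ hq hτ hconj he]
  refine Nat.add_right_cancel (h1.trans ?_)
  rw [← Finset.sum_add_distrib]
  conv_lhs => rw [← h2]
  refine Finset.sum_congr rfl fun i _ => ?_
  have h3 : N = min (N - e i) (e (τ i)) + max (e i) (N - e (τ i)) := by
    have := he i
    have := he (τ i)
    omega
  conv_lhs => rw [h3]
  ring

theorem avgHermitianHullDim_eq_sum [Finite F] [DecidableEq ι] (hirr : ∀ i, Irreducible (f i))
    (hcop : Pairwise fun i j => IsCoprime (f i) (f j)) (hP : ∏ i, f i ^ N = X ^ n - C lam)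
    (hlam : lam ^ (q + 1) = 1) (hσ : ∀ x, σ x = x ^ q) (hq : q ≠ 0)
    (hτ : Function.Involutive τ) (hconj : ∀ i, Associated (conjReverse σ (f i)) (f (τ i))) :
    avgHermitianHullDim n lam q =
      ∑ i, (f i).natDegree * (if τ i = i then selfMean N else pairMean N) := by
  classical
  let K : (ι → Fin (N + 1)) → Submodule F (Fin n → F) :=
    fun e => polyCode n lam (∏ i, f i ^ (e i : ℕ))
  have hdvd : ∀ e : ι → Fin (N + 1), ∏ i, f i ^ (e i : ℕ) ∣ X ^ n - C lam := fun e => by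
    rw [← hP]
    exact Finset.prod_dvd_prod_of_dvd _ _ fun i _ => pow_dvd_pow _ (Fin.is_le _)
  -- The generator of one code is a codeword of the other, which compares exponents; symmetry gives
  -- injectivity.
  have hKle : ∀ e e', K e = K e' → ∀ i, (e' i : ℕ) ≤ e i := by
    intro e e' h i
    have h1 : residueVec n lam (∏ i, f i ^ (e i : ℕ)) ∈ K e :=
      (residueVec_mem_polyCode_iff (hdvd e) _).mpr dvd_rfl
    rw [h, residueVec_mem_polyCode_iff (hdvd e'), prod_pow_dvd_iff hcop] at h1
    exact (pow_dvd_prod_pow_iff hirr hcop _ _ _).mp (h1 i)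
  have hKinj : Function.Injective K := fun e e' h => funext fun i =>
    Fin.ext (le_antisymm (hKle e' e h.symm i) (hKle e e' h i))
  have hrange : constacyclicCodes n lam = Set.range K := by
    ext D
    constructor
    · intro hD
      obtain ⟨g, hg, rfl⟩ := exists_polyCode_eq hD
      have hg' := hg
      rw [← hP] at hg'
      obtain ⟨e, he, hge⟩ := exists_associated_prod_pow hirr N _ hg'
      exact ⟨fun i => ⟨e i, Nat.lt_succ_of_le (he i)⟩,
        (polyCode_eq_of_associated hg hge).symm⟩
    · rintro ⟨e, rfl⟩
      exact polyCode_mem_constacyclicCodes lam _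
  have hfin : (Set.toFinite (constacyclicCodes n lam)).toFinset = Finset.univ.image K := by
    ext D
    simp [hrange]
  have hcard : (constacyclicCodes n lam).ncard = (N + 1) ^ Fintype.card ι := by
    rw [hrange, Set.ncard_range_of_injective hKinj]
    simp
  rw [avgHermitianHullDim, hfin, Finset.sum_image fun _ _ _ _ h => hKinj h, hcard]
  have hdim : ∀ e : ι → Fin (N + 1), (Module.finrank F (hermitianHull q (K e)) : ℝ) =
      ∑ i, (f i).natDegree * ((min (N - e i) (e (τ i)) : ℕ) : ℝ) := by
    intro e
    rw [finrank_hermitianHull_polyCode_prod_pow hirr hcop hP hlam hσ hq hτ hconj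
      fun i => Fin.is_le _]
    push_cast
    rfl
  simp only [hdim]
  rw [← Finset.sum_div, Finset.sum_comm, Finset.sum_div]
  refine Finset.sum_congr rfl fun i _ => ?_
  rw [← Finset.mul_sum, mul_div_assoc]
  congr 1
  push_cast
  split_ifs with h
  · rw [h]
    have := sum_fun_eval i (fun a : Fin (N + 1) => ((min (N - a) a : ℕ) : ℝ))
    simp only [Fintype.card_fin] at this
    rw [selfMean, ← this]
    push_cast
    rfl
  · have := sum_fun_eval₂ h (fun a b : Fin (N + 1) => ((min (N - a) b : ℕ) : ℝ))
    simp only [Fintype.card_fin] at this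
    rw [pairMean, ← this]
    push_cast
    rfl

end Average

/-! ### Conjugate reciprocals of minimal polynomials -/

section Conjugates

variable {F K : Type*} [Field F] [Field K] [Algebra F K] {q : ℕ}

theorem aeval_conjReverse {σ : F →+* F} (hσ : ∀ x, σ x = x ^ q) {σK : K →+* K}
    (hσK : ∀ x, σK x = x ^ q) {x : K} (hx : x ≠ 0) {g : F[X]} (hg : aeval x g = 0) :
    aeval (x⁻¹ ^ q) (conjReverse σ g) = 0 := by
  have hcomp : (algebraMap F K).comp σ = σK.comp (algebraMap F K) := by
    ext a
    simp [hσ, hσK]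
  have := invertibleOfNonzero hx
  have h1 : eval₂ (algebraMap F K) x⁻¹ g.reverse = 0 := by
    have := (eval₂_reverse_eq_zero_iff (algebraMap F K) x g).mpr hg
    simpa using this
  rw [conjReverse, aeval_def, eval₂_map, hcomp, ← hσK, ← hom_eval₂, h1, map_zero]

theorem conjReverse_natDegree_le (σ : F →+* F) (g : F[X]) :
    (conjReverse σ g).natDegree ≤ g.natDegree :=
  natDegree_map_le.trans g.reverse_natDegree_le

variable [Finite K]

theorem minpoly_eq_minpoly_iff_exists_pow [Normal F K] (hF : Nat.card F = q ^ 2) (x y : K) :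
    minpoly F x = minpoly F y ↔ ∃ i : ℕ, y = x ^ q ^ (2 * i) := by
  have hfin : Finite F := Finite.of_injective _ (algebraMap F K).injective
  have := Fintype.ofFinite F
  have : Module.Finite F K := inferInstance
  have hpow : ∀ i : ℕ, (FiniteField.frobeniusAlgEquivOfAlgebraic F K ^ i) x = x ^ q ^ (2 * i) := by
    intro i
    rw [AlgEquiv.coe_pow, FiniteField.coe_frobeniusAlgEquivOfAlgebraic_iterate,
      Fintype.card_eq_nat_card, hF, pow_mul]
  constructor
  · intro h
    obtain ⟨s, hs⟩ := (isConjRoot_iff_exists_algEquiv.mp ((isConjRoot_def (R := F)).mpr h.symm))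
    obtain ⟨i, rfl⟩ := (FiniteField.bijective_frobeniusAlgEquivOfAlgebraic_pow F K).2 s
    exact ⟨i, hs ▸ hpow i⟩
  · rintro ⟨i, rfl⟩
    rw [← hpow, minpoly.algEquiv_eq]

/-- Divisibility holds since `x⁻¹ ^ q` is a root. Degrees do not increase along `x ↦ x⁻¹ ^ q`, and
two steps give the conjugate `x ^ q ^ 2` of `x`, so they are equal. -/
theorem associated_conjReverse_minpoly [Normal F K] (hF : Nat.card F = q ^ 2)
    {σ : F →+* F} (hσ : ∀ x, σ x = x ^ q) {σK : K →+* K}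
    (hσK : ∀ x, σK x = x ^ q) {x : K} (hx : x ≠ 0) :
    Associated (conjReverse σ (minpoly F x)) (minpoly F (x⁻¹ ^ q)) := by
  have hint : ∀ y : K, IsIntegral F y := fun y => Normal.isIntegral ‹_› y
  have hne : ∀ y : K, conjReverse σ (minpoly F y) ≠ 0 := fun y => by
    rw [conjReverse, Polynomial.map_ne_zero_iff σ.injective, Ne, reverse_eq_zero]
    exact minpoly.ne_zero (hint y)
  have hdvd : ∀ y : K, y ≠ 0 → minpoly F (y⁻¹ ^ q) ∣ conjReverse σ (minpoly F y) := fun y hy =>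
    minpoly.dvd F _ (aeval_conjReverse hσ hσK hy (minpoly.aeval F y))
  have hle : ∀ y : K, y ≠ 0 → (minpoly F (y⁻¹ ^ q)).natDegree ≤ (minpoly F y).natDegree :=
    fun y hy => (natDegree_le_of_dvd (hdvd y hy) (hne y)).trans (conjReverse_natDegree_le σ _)
  have h2 : minpoly F ((x⁻¹ ^ q)⁻¹ ^ q) = minpoly F x := by
    refine ((minpoly_eq_minpoly_iff_exists_pow hF _ _).mpr ⟨1, ?_⟩).symm
    simp only [inv_pow, inv_inv, ← pow_mul, mul_one, sq]
  have h3 := hle (x⁻¹ ^ q) (pow_ne_zero _ (inv_ne_zero hx))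
  rw [h2] at h3
  exact (associated_of_dvd_of_natDegree_le (hdvd x hx) (hne x)
    ((conjReverse_natDegree_le σ _).trans h3)).symm

/-- Conjugates over `F` are the powers `x ^ q ^ (2 * i)`. Cancelling one Frobenius in `x⁻¹ ^ q = x ^
q ^ (2 * i)` leaves the odd exponent `2 * i - 1`. -/
theorem minpoly_inv_pow_eq_iff [Normal F K] (hF : Nat.card F = q ^ 2) {σK : K →+* K}
    (hσK : ∀ x, σK x = x ^ q) {x : K} (hx : x ≠ 0) :
    minpoly F (x⁻¹ ^ q) = minpoly F x ↔ orderOf x ∈ oddGoodIntegers q := by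
  rw [eq_comm, minpoly_eq_minpoly_iff_exists_pow hF]
  have hpos : 1 ≤ orderOf x := by
    have h : orderOf (Units.mk0 x hx) = orderOf x := by rw [← orderOf_units]; rfl
    rw [← h]
    exact orderOf_pos _
  have hinv : ∀ i : ℕ, x⁻¹ ^ q = x ^ q ^ (i + 1) ↔ x ^ (q ^ i + 1) = 1 := by
    intro i
    rw [pow_succ q, pow_mul, ← hσK, ← hσK, σK.injective.eq_iff, pow_succ,
      eq_comm, ← mul_eq_one_iff_eq_inv₀ hx]
  constructor
  · rintro ⟨i, hi⟩
    refine ⟨hpos, ?_⟩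
    -- For `i = 0` no factor `q` can be cancelled, but `x⁻¹ ^ q = x` gives `x ^ (q + 1) = 1`
    -- directly.
    rcases i with _ | i
    · refine ⟨1, odd_one, orderOf_dvd_of_pow_eq_one ?_⟩
      simp only [mul_zero, pow_zero, pow_one] at hi
      rw [inv_pow] at hi
      rw [pow_one, pow_succ']
      exact (mul_eq_one_iff_eq_inv₀ (pow_ne_zero _ hx)).mpr hi.symm
    · exact ⟨2 * i + 1, odd_two_mul_add_one i, orderOf_dvd_of_pow_eq_one ((hinv _).mp hi)⟩
  · rintro ⟨-, i, ⟨k, rfl⟩, hd⟩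
    exact ⟨k + 1, (hinv _).mpr (orderOf_dvd_iff_pow_eq_one.mp hd)⟩

end Conjugates

/-! ### The average as a sum over roots -/

section RootFormula

variable {F K : Type*} [Field F] [Finite F] [Field K] [Algebra F K] [Fintype K] [DecidableEq K]
  {q p ν k : ℕ} {lam μ : F}

theorem avgHermitianHullDim_eq_sum_roots [Normal F K] (hp : p.Prime) [CharP F p]
    (hF : Nat.card F = q ^ 2)
    {σ : F →+* F} (hσ : ∀ x, σ x = x ^ q) {σK : K →+* K} (hσK : ∀ x, σK x = x ^ q)
    (hq : q ≠ 0) (hlam : lam ^ (q + 1) = 1) (hμ : μ ^ (q + 1) = 1) (hμlam : μ ^ p ^ ν = lam)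
    (hk : ¬ p ∣ k) (hsplit : ((X ^ k - C μ : F[X]).map (algebraMap F K)).Splits) :
    (Finset.univ.filter fun x : K => x ^ k = algebraMap F K μ).card = k ∧
    avgHermitianHullDim (k * p ^ ν) lam q =
      ∑ x : K with x ^ k = algebraMap F K μ,
        (open Classical in
          if orderOf x ∈ oddGoodIntegers q then selfMean (p ^ ν) else pairMean (p ^ ν)) := by
  classical
  have hk0 : k ≠ 0 := by rintro rfl; simp at hk
  have : NeZero (k * p ^ ν) := ⟨mul_ne_zero hk0 (pow_ne_zero _ hp.ne_zero)⟩
  have : Fact p.Prime := ⟨hp⟩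
  have hμ0 : μ ≠ 0 := by rintro rfl; simp at hμ
  have hint : ∀ y : K, IsIntegral F y := fun y => Normal.isIntegral ‹_› y
  set Z : Finset K := Finset.univ.filter fun x : K => x ^ k = algebraMap F K μ with hZ
  have hmemZ : ∀ x, x ∈ Z ↔ x ^ k = algebraMap F K μ := fun x => by simp [hZ]
  have hZ0 : ∀ x ∈ Z, x ≠ 0 := by
    rintro x hx rfl
    rw [hmemZ, zero_pow hk0] at hx
    exact hμ0 ((map_eq_zero _).mp hx.symm)
  set Q : F[X] := X ^ k - C μ with hQ
  have hQm : Q.Monic := monic_X_pow_sub_C μ hk0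
  have hroot : ∀ x, x ∈ Z ↔ aeval x Q = 0 := fun x => by
    rw [hmemZ, hQ, map_sub, map_pow, aeval_X, aeval_C, sub_eq_zero]
  have hcardZ : Z.card = k := by
    have h := card_rootSet_eq_natDegree (separable_X_pow_sub_C' p k μ hk hμ0) hsplit
    rw [natDegree_X_pow_sub_C] at h
    rw [← h, ← Set.toFinset_card]
    congr 1
    ext x
    rw [hroot, Set.mem_toFinset, mem_rootSet_of_ne hQm.ne_zero]
  refine ⟨hcardZ, ?_⟩
  have hxi : ∀ x ∈ Z, x⁻¹ ^ q ∈ Z := by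
    intro x hx
    rw [hmemZ] at hx ⊢
    rw [← pow_mul, mul_comm, pow_mul, inv_pow, hx, inv_pow, ← map_pow, ← map_inv₀]
    congr 1
    rw [eq_comm, ← mul_eq_one_iff_eq_inv₀ (pow_ne_zero _ hμ0), ← pow_succ', hμ]
  -- The degree weight of an irreducible factor is its number of roots, which turns the sum over
  -- factors into one over roots.
  have hfib : ∀ x ∈ Z, (Z.filter fun y => minpoly F y = minpoly F x).card =
      (minpoly F x).natDegree := by
    intro x hx
    rw [← card_rootSet_eq_natDegree (K := K) (PerfectField.separable_of_irreducible
      (minpoly.irreducible (hint x))) (Normal.splits ‹_› x), ← Set.toFinset_card]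
    congr 1
    ext y
    rw [Finset.mem_filter, Set.mem_toFinset, mem_rootSet_of_ne (minpoly.ne_zero (hint x))]
    constructor
    · rintro ⟨-, h⟩
      rw [← h, minpoly.aeval]
    · intro h
      have h1 := minpoly.eq_of_irreducible_of_monic (minpoly.irreducible (hint x)) h
        (minpoly.monic (hint x))
      refine ⟨?_, h1.symm⟩
      rw [hroot] at hx ⊢
      exact (minpoly.dvd_iff.mp (h1 ▸ minpoly.dvd F x hx))
  let S : Finset F[X] := Z.image (minpoly F)
  have hSex : ∀ i : S, ∃ x ∈ Z, minpoly F x = i := fun i => Finset.mem_image.mp i.2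
  choose ρ hρZ hρ using hSex
  let τ : S → S := fun i =>
    ⟨minpoly F ((ρ i)⁻¹ ^ q), Finset.mem_image_of_mem _ (hxi _ (hρZ i))⟩
  have hassoc : ∀ x ∈ Z, Associated (conjReverse σ (minpoly F x)) (minpoly F (x⁻¹ ^ q)) :=
    fun x hx => associated_conjReverse_minpoly hF hσ hσK (hZ0 x hx)
  -- `τ` does not depend on the chosen root `ρ i`.
  have hτx : ∀ (i : S), ∀ x ∈ Z, minpoly F x = i → (τ i : F[X]) = minpoly F (x⁻¹ ^ q) := by
    intro i x hx hxi
    refine eq_of_monic_of_associated (minpoly.monic (hint _)) (minpoly.monic (hint _)) ?_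
    have h1 := hassoc _ (hρZ i)
    rw [hρ, ← hxi] at h1
    exact h1.symm.trans (hassoc x hx)
  have hτ : Function.Involutive τ := by
    intro i
    refine Subtype.ext ?_
    rw [hτx (τ i) _ (hxi _ (hρZ i)) rfl, ← hρ i]
    refine ((minpoly_eq_minpoly_iff_exists_pow hF _ _).mpr ⟨1, ?_⟩).symm
    simp only [inv_pow, inv_inv, ← pow_mul, mul_one, sq]
  have hirr : ∀ i : S, Irreducible (i : F[X]) := fun i => by
    rw [← hρ i]; exact minpoly.irreducible (hint _)
  have hmonic : ∀ i : S, (i : F[X]).Monic := fun i => by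
    rw [← hρ i]; exact minpoly.monic (hint _)
  have hcop : Pairwise fun i j : S => IsCoprime (i : F[X]) (j : F[X]) := by
    intro i j hij
    rw [(hirr i).coprime_iff_not_dvd]
    intro hd
    exact hij (Subtype.ext (eq_of_monic_of_associated (hmonic i) (hmonic j)
      ((hirr i).associated_of_dvd (hirr j) hd)))
  have hdeg : ∀ i : S, (Z.filter fun y => minpoly F y = i).card = (i : F[X]).natDegree := by
    intro i
    rw [← hρ i]
    exact hfib _ (hρZ i)
  have hprod : ∏ i : S, (i : F[X]) = Q := by
    refine (eq_of_monic_of_dvd_of_natDegree_le (monic_prod_of_monic _ _ fun i _ => hmonic i) hQm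
      (Finset.prod_dvd_of_coprime (fun i _ j _ hij => hcop hij) fun i _ => ?_) ?_).symm
    · rw [← hρ i]
      exact minpoly.dvd F _ ((hroot _).mp (hρZ i))
    · rw [natDegree_prod_of_monic _ _ fun i _ => hmonic i, hQ, natDegree_X_pow_sub_C]
      simp only [← hdeg]
      rw [Finset.sum_coe_sort S (fun i => (Z.filter fun y => minpoly F y = i).card),
        ← Finset.card_eq_sum_card_image, hcardZ]
  have hP : ∏ i : S, (i : F[X]) ^ p ^ ν = X ^ (k * p ^ ν) - C lam := by
    rw [Finset.prod_pow, hprod, hQ, sub_pow_char_pow, ← pow_mul, ← C_pow, hμlam]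
  have hconj : ∀ i : S, Associated (conjReverse σ (i : F[X])) (τ i) := fun i => by
    have h := hassoc _ (hρZ i)
    rwa [hρ i] at h
  rw [avgHermitianHullDim_eq_sum hirr hcop hP hlam hσ hq hτ hconj,
    ← Finset.sum_fiberwise_of_maps_to (g := minpoly F) (t := S)
      (fun x hx => Finset.mem_image_of_mem _ hx), ← Finset.sum_coe_sort S]
  refine Finset.sum_congr rfl fun i _ => ?_
  rw [← hdeg, ← nsmul_eq_mul, ← Finset.sum_const]
  refine Finset.sum_congr rfl fun x hx => ?_
  obtain ⟨hxZ, hxi'⟩ := Finset.mem_filter.mp hx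
  have : τ i = i ↔ orderOf x ∈ oddGoodIntegers q := by
    rw [← minpoly_inv_pow_eq_iff (F := F) hF hσK (hZ0 x hxZ), Subtype.ext_iff,
      hτx i x hxZ hxi', hxi']
  simp only [this]

end RootFormula

/-! ### Counting roots of good order -/

section RootCount

variable {K : Type*} [Field K] [Fintype K] {q k r : ℕ} {μ : K}

/-- The elements of a finite multiplicative group whose order divides some `q ^ i + 1`
with `i` odd. -/
def goodOrderSubgroup (G : Type*) [CommGroup G] [Finite G] (q : ℕ) : Subgroup G where
  carrier := {u | orderOf u ∈ oddGoodIntegers q}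
  one_mem' := by simpa using one_mem_oddGoodIntegers q
  mul_mem' {a b} ha hb := oddGoodIntegers_of_dvd (Commute.orderOf_mul_dvd_lcm (Commute.all a b))
    (lcm_mem_oddGoodIntegers ha hb)
  inv_mem' {a} ha := by simpa using ha

/-- The quotient of two good roots is a `k`-th root of unity of good order. Such elements form a
cyclic group, so its order is the order of a generator and lies in `M_q`. -/
theorem exists_card_good_roots_le [DecidableEq K] (hμ : μ ≠ 0)
    (hk : (Finset.univ.filter fun x : K => x ^ k = μ).card = k) (hk0 : k ≠ 0) :
    ∃ h ∈ oddGoodIntegers q, h ∣ k ∧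
      (open Classical in
        ((Finset.univ.filter fun x : K => x ^ k = μ).filter
          fun x => orderOf x ∈ oddGoodIntegers q).card ≤ h) := by
  classical
  have : NeZero k := ⟨hk0⟩
  set Z := Finset.univ.filter fun x : K => x ^ k = μ with hZ
  have hmemZ : ∀ x, x ∈ Z ↔ x ^ k = μ := fun x => by simp [hZ]
  have hZ0 : ∀ x ∈ Z, x ≠ 0 := by
    rintro x hx rfl
    rw [hmemZ, zero_pow hk0] at hx
    exact hμ hx.symm
  have hquot : ∀ (x y : K) (hx : x ∈ Z) (hy : y ∈ Z),
      Units.mk0 x (hZ0 x hx) / Units.mk0 y (hZ0 y hy) ∈ rootsOfUnity k K := by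
    intro x y hx hy
    rw [mem_rootsOfUnity, div_pow, div_eq_one]
    ext
    simp [(hmemZ _).mp hx, (hmemZ _).mp hy]
  have hinj : ∀ (x x' y : K) (hx : x ∈ Z) (hx' : x' ∈ Z) (hy : y ∈ Z),
      Units.mk0 x (hZ0 x hx) / Units.mk0 y (hZ0 y hy) =
        Units.mk0 x' (hZ0 x' hx') / Units.mk0 y (hZ0 y hy) → x = x' := by
    intro x x' y hx hx' hy h
    simpa using congrArg Units.val (div_left_injective h)
  obtain ⟨y, hy⟩ : Z.Nonempty := Finset.card_pos.mp (by omega)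
  -- Dividing the `k` roots by one of them gives `k` distinct roots of unity.
  have hcardU : Nat.card (rootsOfUnity k K) = k := by
    refine le_antisymm (by simpa using card_rootsOfUnity K k) ?_
    conv_lhs => rw [← hk]
    rw [← show Nat.card Z = Z.card by simp]
    exact Nat.card_le_card_of_injective (fun x : Z =>
      (⟨_, hquot x y x.2 hy⟩ : rootsOfUnity k K)) fun x x' h =>
        Subtype.ext (hinj _ _ _ x.2 x'.2 hy (congrArg Subtype.val h))
  let H : Subgroup Kˣ := rootsOfUnity k K ⊓ goodOrderSubgroup Kˣ q
  have hHk : Nat.card H ∣ k := by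
    conv_rhs => rw [← hcardU]
    exact Subgroup.card_dvd_of_le inf_le_left
  refine ⟨Nat.card H, ?_, hHk, ?_⟩
  · obtain ⟨g, hg⟩ := IsCyclic.exists_ofOrder_eq_natCard (α := H)
    rw [← hg, ← Subgroup.orderOf_coe]
    exact g.2.2
  · set S := Z.filter fun x => orderOf x ∈ oddGoodIntegers q with hS
    rcases S.eq_empty_or_nonempty with h | ⟨z, hz⟩
    · simp [h]
    · have hSZ : ∀ x ∈ S, x ∈ Z := fun x hx => (Finset.mem_filter.mp hx).1
      have hSo : ∀ x (hx : x ∈ S),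
          Units.mk0 x (hZ0 x (hSZ x hx)) ∈ goodOrderSubgroup Kˣ q := by
        intro x hx
        change orderOf (Units.mk0 x (hZ0 x (hSZ x hx))) ∈ oddGoodIntegers q
        rw [← orderOf_units]
        exact (Finset.mem_filter.mp hx).2
      rw [← show Nat.card S = S.card by simp]
      exact Nat.card_le_card_of_injective (fun x : S =>
        (⟨_, hquot x z (hSZ x x.2) (hSZ z hz), (goodOrderSubgroup Kˣ q).div_mem (hSo x x.2) (hSo z hz)⟩ : H))
        fun x x' h => Subtype.ext (hinj _ _ _ (hSZ x x.2) (hSZ x' x'.2) (hSZ z hz) (congrArg Subtype.val h))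

/-- Since `orderOf x = gcd (orderOf x) k * r` with `r` even, the gcd has smaller 2-adic valuation
than `orderOf x`, hence the same one as `k`. -/
theorem padicValNat_two_orderOf {x : K} (hx : x ≠ 0) (hk0 : k ≠ 0) (hr : orderOf (x ^ k) = r)
    (hre : Even r) : padicValNat 2 (orderOf x) = padicValNat 2 k + padicValNat 2 r := by
  have ho : orderOf x ≠ 0 := by
    have h : orderOf (Units.mk0 x hx) = orderOf x := by rw [← orderOf_units]; rfl
    rw [← h]
    exact (orderOf_pos _).ne'
  rw [orderOf_pow' x hk0] at hr
  have hg : (orderOf x).gcd k ≠ 0 := (Nat.gcd_pos_of_pos_right _ (Nat.pos_of_ne_zero hk0)).ne'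
  have hog : orderOf x = (orderOf x).gcd k * r := by
    rw [← hr, Nat.mul_div_cancel' (Nat.gcd_dvd_left _ _)]
  have hr0 : r ≠ 0 := by
    rintro rfl
    exact ho (by simpa using hog)
  have h1 : padicValNat 2 (orderOf x) = padicValNat 2 ((orderOf x).gcd k) + padicValNat 2 r := by
    conv_lhs => rw [hog]
    exact padicValNat.mul hg hr0
  have h2 : 1 ≤ padicValNat 2 r :=
    one_le_padicValNat_of_dvd hr0 hre.two_dvd
  have h3 : padicValNat 2 ((orderOf x).gcd k) ≤ padicValNat 2 k :=
    (padicValNat_dvd_iff_le hk0).mp (pow_padicValNat_dvd.trans (Nat.gcd_dvd_right _ _))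
  have h4 : min (padicValNat 2 (orderOf x)) (padicValNat 2 k) ≤
      padicValNat 2 ((orderOf x).gcd k) :=
    (padicValNat_dvd_iff_le hg).mp (Nat.dvd_gcd
      ((pow_dvd_pow 2 (min_le_left _ _)).trans pow_padicValNat_dvd)
      ((pow_dvd_pow 2 (min_le_right _ _)).trans pow_padicValNat_dvd))
  omega

end RootCount

/-! ### Bounds on the good share and the final estimates -/

theorem two_mul_le_of_not_mem_oddGoodIntegers {q h k : ℕ} (hh : h ∈ oddGoodIntegers q)
    (hd : h ∣ k) (hk0 : k ≠ 0) (hk : k ∉ oddGoodIntegers q) : 2 * h ≤ k := by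
  obtain ⟨c, rfl⟩ := hd
  have : c ≠ 1 := by rintro rfl; exact hk (by simpa using hh)
  have : c ≠ 0 := by rintro rfl; simp at hk0
  nlinarith [show 2 ≤ c by omega, hh.1]

theorem three_mul_le_of_not_mem_oddGoodIntegers {q h k γ : ℕ} (hh : h ∈ oddGoodIntegers q)
    (hd : h ∣ k) (hk0 : k ≠ 0) (hk : k ∉ oddGoodIntegers q) (hγ : 2 ^ γ ∣ q + 1)
    (hkγ : padicValNat 2 k ≤ γ) : 3 * h ≤ k := by
  obtain ⟨c, rfl⟩ := hd
  have h1 : c ≠ 1 := by rintro rfl; exact hk (by simpa using hh)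
  have h0 : c ≠ 0 := by rintro rfl; simp at hk0
  -- If `k = 2 * h`, the odd part of `k` divides `h` and is good, and the 2-part divides `q + 1`;
  -- their lcm `k` would be good.
  have h2 : c ≠ 2 := by
    rintro rfl
    obtain ⟨b, hb, hkb⟩ := exists_odd_eq_two_pow_padicValNat_mul hk0
    have hbh : b ∣ h := by
      refine (Nat.coprime_two_right.mpr hb).dvd_of_dvd_mul_right ?_
      exact Dvd.intro_left _ hkb.symm
    refine hk (oddGoodIntegers_of_dvd ?_
      (lcm_mem_oddGoodIntegers (two_pow_mem_oddGoodIntegers hγ hkγ)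
        (oddGoodIntegers_of_dvd hbh hh)))
    conv_lhs => rw [hkb]
    exact (Nat.Coprime.pow_left _ (Nat.coprime_two_left.mpr hb)).mul_dvd_of_dvd_of_dvd
      (Nat.dvd_lcm_left _ _) (Nat.dvd_lcm_right _ _)
  nlinarith [show 3 ≤ c by omega, hh.1]

/-- The average Hermitian hull dimension in terms of the number `s` of roots of
`X ^ nbar - lam ^ (1 / p ^ ν)` whose order lies in `M_q`. -/
theorem exists_avgHermitianHullDim_eq {F : Type*} [Field F] [Finite F]
    {p m q : ℕ} (hp : p.Prime) (hq : q = p ^ m) (hF : Nat.card F = q ^ 2)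
    {γ : ℕ} (hγ : ¬ 2 ^ (γ + 1) ∣ q + 1)
    {k : ℕ} (ν : ℕ) (hk : ¬ p ∣ k) {lam : F} {r : ℕ}
    (hr : orderOf lam = r) (hrq : r ∣ q + 1) :
    ∃ s : ℕ, s ≤ k ∧
      avgHermitianHullDim (k * p ^ ν) lam q =
        s * selfMean (p ^ ν) + (k - s) * pairMean (p ^ ν) ∧
      (∃ h ∈ oddGoodIntegers q, h ∣ k ∧ s ≤ h) ∧
      (Even r → γ < padicValNat 2 k + padicValNat 2 r → s = 0) ∧
      (r * k ∈ oddGoodIntegers q → s = k) := by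
  classical
  have hk0 : k ≠ 0 := by rintro rfl; simp at hk
  have hq0 : q ≠ 0 := by rw [hq]; exact pow_ne_zero _ hp.ne_zero
  have : Fact p.Prime := ⟨hp⟩
  have hchar : CharP F p := by
    have := Fintype.ofFinite F
    refine charP_of_card_eq_prime_pow (f := m * 2) ?_
    rw [Fintype.card_eq_nat_card, hF, hq, pow_mul]
  -- Frobenius is bijective on `F` and preserves orders, so `μ` again has order `r`.
  obtain ⟨μ, hμlam⟩ := (bijective_iterateFrobenius F p ν).2 lam
  have hμr : orderOf μ = r := by
    rw [← hr, ← hμlam]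
    exact (orderOf_injective (iterateFrobenius F p ν).toMonoidHom
      (iterateFrobenius F p ν).injective μ).symm
  rw [iterateFrobenius_def] at hμlam
  have hlam1 : lam ^ (q + 1) = 1 := orderOf_dvd_iff_pow_eq_one.mp (hr ▸ hrq)
  have hμ1 : μ ^ (q + 1) = 1 := orderOf_dvd_iff_pow_eq_one.mp (hμr ▸ hrq)
  let K := (X ^ k - C μ : F[X]).SplittingField
  have hKfin : Finite K := Module.finite_of_finite F
  have := Fintype.ofFinite K
  have hcharK : CharP K p := charP_of_injective_algebraMap (algebraMap F K).injective p
  obtain ⟨hcard, havg⟩ := avgHermitianHullDim_eq_sum_roots (K := K) (ν := ν) hp hF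
    (σ := iterateFrobenius F p m) (fun x => by rw [iterateFrobenius_def, hq])
    (σK := iterateFrobenius K p m) (fun x => by rw [iterateFrobenius_def, hq])
    hq0 hlam1 hμ1 hμlam hk (SplittingField.splits _)
  set Z : Finset K := Finset.univ.filter fun x : K => x ^ k = algebraMap F K μ with hZ
  have hμ0 : algebraMap F K μ ≠ 0 := by
    rw [Ne, map_eq_zero]; rintro rfl; simp at hμ1
  have hμK : orderOf (algebraMap F K μ) = r := by
    rw [← hμr]
    exact orderOf_injective (algebraMap F K).toMonoidHom (algebraMap F K).injective μ
  have hmemZ : ∀ x, x ∈ Z ↔ x ^ k = algebraMap F K μ := fun x => by simp [hZ]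
  have hsplit := Finset.card_filter_add_card_filter_not (s := Z)
    (fun x : K => orderOf x ∈ oddGoodIntegers q)
  rw [hcard] at hsplit
  refine ⟨(Z.filter fun x => orderOf x ∈ oddGoodIntegers q).card, by omega, ?_,
    exists_card_good_roots_le hμ0 hcard hk0, ?_, ?_⟩
  · rw [havg, Finset.sum_ite, Finset.sum_const, Finset.sum_const, nsmul_eq_mul, nsmul_eq_mul]
    have : ((Z.filter fun x => orderOf x ∈ oddGoodIntegers q).card : ℝ) +
      ((Z.filter fun x => orderOf x ∉ oddGoodIntegers q).card : ℝ) = k := by exact_mod_cast hsplit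
    rw [← this]
    ring
  · intro hre hlt
    rw [Finset.card_eq_zero, Finset.filter_eq_empty_iff]
    intro x hx hgood
    rw [hmemZ] at hx
    have hx0 : x ≠ 0 := by
      rintro rfl
      rw [zero_pow hk0] at hx
      exact hμ0 hx.symm
    have h1 := padicValNat_two_orderOf hx0 hk0 (hx ▸ hμK) hre
    have h2 := padicValNat_two_le_of_mem_oddGoodIntegers hγ hgood
    omega
  · intro hrk
    conv_rhs => rw [← hcard]
    rw [Finset.filter_true_of_mem]
    intro x hx
    rw [hmemZ] at hx
    refine oddGoodIntegers_of_dvd (orderOf_dvd_of_pow_eq_one ?_) hrk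
    rw [mul_comm, pow_mul, hx, ← hμK, pow_orderOf_eq_one]

theorem theorem2 {F : Type*} [Field F] [Finite F]
    (p m q : ℕ) (hp : p.Prime) (hm : 0 < m) (hq : q = p ^ m)
    (hF : Nat.card F = q ^ 2)
    (γ : ℕ) (hγ : 2 ^ γ ∣ q + 1 ∧ ¬ 2 ^ (γ + 1) ∣ q + 1)
    (n nbar ν : ℕ) (hn : n = nbar * p ^ ν) (hnbar : ¬ p ∣ nbar)
    (lam : F) (hlam : lam ≠ 0) (r : ℕ) (hr : orderOf lam = r) (hrq : r ∣ q + 1) :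
    (avgHermitianHullDim n lam q = 0 ↔
      padicValNat 2 nbar + padicValNat 2 r ≤ γ ∧
        r ∈ oddGoodIntegers q ∧ n ∈ oddGoodIntegers q) ∧
    (Even r →
      (padicValNat 2 nbar + padicValNat 2 r ≤ γ → r ∈ oddGoodIntegers q →
        n ∉ oddGoodIntegers q →
        (n : ℝ) / 6 ≤ avgHermitianHullDim n lam q ∧
          avgHermitianHullDim n lam q < (n : ℝ) / 3) ∧
      (γ < padicValNat 2 nbar + padicValNat 2 r ∨ r ∉ oddGoodIntegers q →
        (n : ℝ) / 4 ≤ avgHermitianHullDim n lam q ∧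
          avgHermitianHullDim n lam q < (n : ℝ) / 3)) ∧
    (Odd r →
      (r ∈ oddGoodIntegers q → n ∉ oddGoodIntegers q →
        (n : ℝ) / 8 ≤ avgHermitianHullDim n lam q ∧
          avgHermitianHullDim n lam q < (n : ℝ) / 3) ∧
      (r ∉ oddGoodIntegers q →
        (n : ℝ) / 4 ≤ avgHermitianHullDim n lam q ∧
          avgHermitianHullDim n lam q < (n : ℝ) / 3)) ∧
    (avgHermitianHullDim n lam q = 0 ∨
      ((n : ℝ) / 8 ≤ avgHermitianHullDim n lam q ∧
        avgHermitianHullDim n lam q < (n : ℝ) / 3)) := by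
  obtain ⟨hγ1, hγ2⟩ := hγ
  have hk0 : nbar ≠ 0 := by rintro rfl; simp at hnbar
  have hq2 : 2 ≤ q := hq ▸ hp.two_le.trans (Nat.le_self_pow hm.ne' p)
  -- Exponent `1` already works, so every clause assuming `r ∉ M_q` is vacuous.
  have hrM : r ∈ oddGoodIntegers q :=
    ⟨Nat.pos_of_dvd_of_pos hrq q.succ_pos, 1, odd_one, by simpa using hrq⟩
  have hr0 : r ≠ 0 := by have := hrM.1; omega
  subst hn
  obtain ⟨s, hsk, havg, ⟨h, hhM, hhk, hsh⟩, hs0, hsfull⟩ :=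
    exists_avgHermitianHullDim_eq hp hq hF hγ2 ν hnbar hr hrq
  have hN : 0 < p ^ ν := pow_pos hp.pos ν
  have hN1 : p ^ ν = 1 ∨ 2 ≤ p ^ ν := by omega
  -- Elements of `M_q` are prime to `p`, as `p` divides `q ^ i`.
  have hnM : nbar * p ^ ν ∈ oddGoodIntegers q → p ^ ν = 1 := by
    rintro ⟨-, i, hi, hd⟩
    rcases Nat.eq_zero_or_pos ν with rfl | hν
    · simp
    exfalso
    have h1 : p ∣ q ^ i + 1 := ((dvd_pow_self p hν.ne').mul_left nbar).trans hd
    have h2 : p ∣ q ^ i := by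
      rw [hq]
      exact dvd_pow (dvd_pow_self p hm.ne') hi.pos.ne'
    exact hp.one_lt.ne' (Nat.dvd_one.mp ((Nat.dvd_add_right h2).mp h1))
  have hodd : Odd r → padicValNat 2 r = 0 := fun hro =>
    padicValNat.eq_zero_of_not_dvd hro.not_two_dvd_nat
  have hkR : (0 : ℝ) < nbar := by exact_mod_cast Nat.pos_of_ne_zero hk0
  have hskR : (s : ℝ) ≤ nbar := by exact_mod_cast hsk
  have hsR : (0 : ℝ) ≤ s := Nat.cast_nonneg s
  have hNR : (1 : ℝ) ≤ (p ^ ν : ℕ) := by exact_mod_cast hN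
  have hA0 := selfMean_nonneg (p ^ ν)
  have hA3 := selfMean_lt hN
  have hB4 := div_four_le_pairMean hN
  have hB3 := pairMean_lt hN
  have hA1 : p ^ ν = 1 → selfMean (p ^ ν) = 0 := fun h => by rw [h, selfMean_one]
  have hA6 : 2 ≤ p ^ ν → ((p ^ ν : ℕ) : ℝ) / 6 ≤ selfMean (p ^ ν) := div_six_le_selfMean
  have hcast : ((nbar * p ^ ν : ℕ) : ℝ) = nbar * (p ^ ν : ℕ) := by push_cast; rfl
  rw [havg, hcast]
  generalize ((p ^ ν : ℕ) : ℝ) = N at *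
  generalize selfMean (p ^ ν) = A at *
  generalize pairMean (p ^ ν) = B at *
  have hlt : s * A + (nbar - s) * B < nbar * N / 3 := by
    rcases hsR.eq_or_lt with h0 | hpos
    · rw [← h0]
      nlinarith
    · nlinarith [mul_lt_mul_of_pos_left hA3 hpos,
        mul_le_mul_of_nonneg_left hB3.le (sub_nonneg.mpr hskR)]
  have hbound : ∀ c : ℝ, c ≤ N / 4 → s * 0 + (nbar - s) * c ≤ s * A + (nbar - s) * B := by
    intro c hc
    have h1 := mul_nonneg hsR hA0
    have h2 := mul_le_mul_of_nonneg_left (hc.trans hB4) (sub_nonneg.mpr hskR)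
    linarith
  have hlarge : 2 ≤ p ^ ν → nbar * N / 6 ≤ s * A + (nbar - s) * B := by
    intro h2
    have h3 := mul_le_mul_of_nonneg_left (hA6 h2) hsR
    have h4 : (nbar - s) * (N / 6) ≤ (nbar - s) * B :=
      mul_le_mul_of_nonneg_left (by linarith) (sub_nonneg.mpr hskR)
    linarith
  -- Here `t` bounds the share of good roots; the values `0`, `1 / 3`, `1 / 2` produce the constants
  -- `1 / 4`, `1 / 6`, `1 / 8`.
  have hsmall : ∀ t : ℝ, s ≤ t * nbar → (1 - t) * (nbar * N / 4) ≤ s * A + (nbar - s) * B := by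
    intro t ht
    have h1 := hbound (N / 4) le_rfl
    nlinarith
  have hzero : Even r → γ < padicValNat 2 nbar + padicValNat 2 r →
      nbar * N / 4 ≤ s * A + (nbar - s) * B := by
    intro he hlt
    have := hsmall 0 (by simp [hs0 he hlt])
    linarith
  have hthird : padicValNat 2 nbar ≤ γ → nbar * p ^ ν ∉ oddGoodIntegers q →
      nbar * N / 6 ≤ s * A + (nbar - s) * B := by
    intro hβ hn
    rcases hN1 with h1 | h2
    · rw [h1, mul_one] at hn
      have h3 := three_mul_le_of_not_mem_oddGoodIntegers hhM hhk hk0 hn hγ1 hβ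
      have h4 : 3 * (s : ℝ) ≤ nbar := by exact_mod_cast (Nat.mul_le_mul_left 3 hsh).trans h3
      have := hsmall (1 / 3) (by linarith)
      linarith
    · exact hlarge h2
  have hhalf : nbar * p ^ ν ∉ oddGoodIntegers q →
      nbar * N / 8 ≤ s * A + (nbar - s) * B := by
    intro hn
    have hnN : 0 ≤ nbar * N := by positivity
    rcases hN1 with h1 | h2
    · rw [h1, mul_one] at hn
      have h3 := two_mul_le_of_not_mem_oddGoodIntegers hhM hhk hk0 hn
      have h4 : 2 * (s : ℝ) ≤ nbar := by exact_mod_cast (Nat.mul_le_mul_left 2 hsh).trans h3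
      have := hsmall (1 / 2) (by linarith)
      linarith
    · linarith [hlarge h2]
  have hiff : s * A + (nbar - s) * B = 0 ↔
      padicValNat 2 nbar + padicValNat 2 r ≤ γ ∧
        r ∈ oddGoodIntegers q ∧ nbar * p ^ ν ∈ oddGoodIntegers q := by
    have hnN : 0 < nbar * N := by positivity
    constructor
    · intro h0
      have hn : nbar * p ^ ν ∈ oddGoodIntegers q := by
        by_contra hn
        linarith [hhalf hn]
      refine ⟨?_, hrM, hn⟩
      rcases r.even_or_odd with he | ho
      · by_contra! hlt
        linarith [hzero he hlt]
      · rw [hodd ho, add_zero]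
        exact padicValNat_two_le_of_mem_oddGoodIntegers hγ2
          (oddGoodIntegers_of_dvd (dvd_mul_right _ _) hn)
    · rintro ⟨hβ, -, hn⟩
      have hk : nbar ∈ oddGoodIntegers q := oddGoodIntegers_of_dvd (dvd_mul_right _ _) hn
      rw [hA1 (hnM hn), hsfull (mul_mem_oddGoodIntegers hγ1 hrq hk hβ)]
      ring
  refine ⟨hiff, fun he => ⟨fun hβ _ hn => ⟨hthird (by omega) hn, hlt⟩, ?_⟩,
    fun ho => ⟨fun _ hn => ⟨hhalf hn, hlt⟩, fun h => absurd hrM h⟩, ?_⟩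
  · rintro (hβ | h)
    · exact ⟨hzero he hβ, hlt⟩
    · exact absurd hrM h
  · by_cases hn : nbar * p ^ ν ∈ oddGoodIntegers q
    · rcases le_or_gt (padicValNat 2 nbar + padicValNat 2 r) γ with hβ | hβ
      · exact Or.inl (hiff.mpr ⟨hβ, hrM, hn⟩)
      · rcases r.even_or_odd with he | ho
        · have hnN : 0 ≤ nbar * N := by positivity
          exact Or.inr ⟨by linarith [hzero he hβ], hlt⟩
        -- For odd `r` the valuation of `r` is zero, and goodness of `n` bounds that of `nbar` by
        -- `γ`: this case is impossible.
        · have := padicValNat_two_le_of_mem_oddGoodIntegers hγ2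
            (oddGoodIntegers_of_dvd (dvd_mul_right nbar (p ^ ν)) hn)
          rw [hodd ho] at hβ
          omega
    · exact Or.inr ⟨hhalf hn, hlt⟩
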